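/- A path diagram of half-length $N\ge 0$ is a Dyck path $u_1u_2\cdots u_{2N}$ (steps $(1,1)$ and $(1,-1)$, from $(0,0)$ to $(2N,0)$, never going below $y=0$) together with integers $s_1,\dots,s_{2N}$ such that $0\le s_i\le h_i$, where $h_i$ is the height of the point from which the step $u_i$ starts. Let $a_{N,m}$ be the number of path diagrams of half-length $N$ with $s_1+\cdots+s_{2N}=m$, and let $$G(t,q)=\sum_{N,m=0}^{\infty}a_{N,m}\,t^{2N}q^m$$ be the generating function of path diagrams (the generating function of the $q$-tangent numbers), a formal power series in $t$ whose coefficients are polynomials in $q$. Then for every $N\ge 0$ $$[t^{2N}]G(t,q)=\frac{1}{(1-q)^{2N+1}}\sum_{m=0}^{N}\frac{q^{m^2+2m}\left(\sum_{l=-m}^{m+1}(-1)^l q^{-l^2+2l}\right)(2m+2)\binom{2N+1}{N+m+1}}{N+m+2}.$$ Here $q$ may be an indeterminate or, more generally, any element $q\ne 0,1$ of a field of characteristic zero. -/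

import Mathlib

open scoped Polynomial PowerSeries

/-- The height at which the `i`-th step of a Dyck path starts: the number of northeast steps minus
the number of southeast steps before it (never negative for a Dyck path). -/
def DyckWord.startHeight (p : DyckWord) (i : ℕ) : ℕ :=
  (p.toList.take i).count DyckStep.U - (p.toList.take i).count DyckStep.D

/-- A possibility function: `pos DyckStep.U j` is the value at the northeast step `a_j` starting at
height `j`, and `pos DyckStep.D k` is the value at the southeast step `b_k` starting at height `k`
(only the values with `k ≥ 1` occur in Dyck paths). -/
abbrev PossibilityFunction : Type := DyckStep → ℕ → ℕ

/-- Path diagrams of half-length `N` for the possibility function `pos`: a Dyck path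
`u = u_1 ⋯ u_{2N}` with a sequence of integers (column heights) `s_i`, `0 ≤ s_i ≤ pos (u_i)`. -/
def PathDiagram (pos : PossibilityFunction) (N : ℕ) : Type :=
  Σ p : {p : DyckWord // p.semilength = N},
    ((i : Fin p.1.toList.length) → Fin (pos (p.1.toList.get i) (p.1.startHeight i) + 1))

instance PathDiagram.instFintype (pos : PossibilityFunction) (N : ℕ) :
    Fintype (PathDiagram pos N) :=
  inferInstanceAs (Fintype (Σ p : {p : DyckWord // p.semilength = N},
    ((i : Fin p.1.toList.length) → Fin (pos (p.1.toList.get i) (p.1.startHeight i) + 1))))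

/-- The sum of the column heights of a path diagram. -/
def PathDiagram.heightSum {pos : PossibilityFunction} {N : ℕ} (d : PathDiagram pos N) : ℕ :=
  ∑ i, (d.2 i : ℕ)

/-- The number of path diagrams of half-length `N` with sum of column heights `m`. -/
def numPathDiagrams (pos : PossibilityFunction) (N m : ℕ) : ℕ :=
  Fintype.card {d : PathDiagram pos N // d.heightSum = m}

/-- `pos (a_j) = j` and `pos (b_k) = k`. -/
def tangentPos : PossibilityFunction := fun _ h => h

/-- The polynomial `∑_m a_{N,m} q^m` (a finite sum), where `a_{N,m}` is the number of path diagrams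
of half-length `N` with sum of column heights `m`. -/
noncomputable def pathDiagramPoly (pos : PossibilityFunction) (N : ℕ) : ℤ[X] :=
  ∑ᶠ m : ℕ, Polynomial.C (numPathDiagrams pos N m : ℤ) * Polynomial.X ^ m

theorem finite_support_numPathDiagrams (pos : PossibilityFunction) (N : ℕ) :
    {m : ℕ | numPathDiagrams pos N m ≠ 0}.Finite := by
  refine (Set.finite_range (PathDiagram.heightSum (pos := pos) (N := N))).subset ?_
  intro m hm
  have h : 0 < Fintype.card {d : PathDiagram pos N // d.heightSum = m} := Nat.pos_of_ne_zero hm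
  obtain ⟨d, hd⟩ := Fintype.card_pos_iff.mp h
  exact ⟨d, hd⟩

/-- The coefficients of `pathDiagramPoly` are the numbers of path diagrams. -/
theorem coeff_pathDiagramPoly (pos : PossibilityFunction) (N m : ℕ) :
    (pathDiagramPoly pos N).coeff m = (numPathDiagrams pos N m : ℤ) := by
  have hsub : (Function.support fun m : ℕ =>
      Polynomial.C (numPathDiagrams pos N m : ℤ) * Polynomial.X ^ m) ⊆
      ((finite_support_numPathDiagrams pos N).toFinset : Set ℕ) := by
    intro k hk
    simp only [Set.Finite.coe_toFinset, Set.mem_ofPred_eq]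
    intro h0
    exact hk (by simp [h0])
  rw [pathDiagramPoly, finsum_eq_sum_of_support_subset _ hsub, Polynomial.finsetSum_coeff]
  simp only [Polynomial.coeff_C_mul_X_pow]
  rw [Finset.sum_ite_eq]
  split_ifs with h
  · rfl
  · have h0 : numPathDiagrams pos N m = 0 := by simpa using h
    simp [h0]

/-- The generating function `∑_{N,m} a_{N,m} t^{2N} q^m` of path diagrams, as a formal power
series in `t` whose coefficients are polynomials in `q`. -/
noncomputable def pathDiagramSeries (pos : PossibilityFunction) : ℤ[X]⟦X⟧ :=
  PowerSeries.mk fun n => if Even n then pathDiagramPoly pos (n / 2) else 0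

/-- The generating function `G(t,q)` of (unrestricted) path diagrams with `pos (a_j) = j`,
`pos (b_k) = k`, as a formal power series in `t`, for an element `q` of a commutative ring `K`
(an indeterminate, or a number). -/
noncomputable def tangentGF {K : Type*} [CommRing K] (q : K) : K⟦X⟧ :=
  PowerSeries.map (Polynomial.eval₂RingHom (Int.castRingHom K) q) (pathDiagramSeries tangentPos)

/-!
The sum over the column heights of a path diagram turns each step that starts at height `h` into a
factor `1 + q + ⋯ + q ^ h`. Hence `(1 - q) ^ (2 * N)` times the coefficient of `t ^ (2 * N)` is the
entry at height `0` of `X ^ (2 * N) e₀`, where `X` (`stepOp`) is tridiagonal with weight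
`1 - q ^ (h + 1)` in row `h` (`coeff_tangentGF`, `stepOp_pow_eq_pathSum`).

Writing powers of `X` in the Chebyshev polynomials `S_k(X)`, which is the binomial expansion of
`(z + 1/z) ^ n`, reduces the problem to the entries of the vectors `S_k(X) e₀`. Let
`H_h(w) = ∑ n, (S_{2n+h}(X) e₀)(h) * w ^ n` and `H(y, w) = ∑ h, H_h(w) * (w * y) ^ h`. The
tridiagonal relation is a first-order inhomogeneous `q`-difference equation of `H` in `y`. The
weights are such that `(1 - y / q) H(y / q, q² w)` and `(1 - y w) H(y, w)` satisfy equations in `y`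
with the same homogeneous part, and this leads to the contiguity relation
`(1 + q² w) (1 - y w) H(y, w) = q³ w (1 + w) (1 - y / q) H(y / q, q² w) + 1 - q w`
(`contiguityDefect_eq_zero`). At `y = 0` it is a first-order `q`-difference equation for `H_0` in
`w`, with a unique power series solution. The partial theta sums
`c_m = q ^ (m ^ 2 + 2 * m) * ∑ l, (-1) ^ l * q ^ (-l ^ 2 + 2 * l)` satisfy
`c_{m+1} = q ^ (2 * m + 3) * c_m + (-1) ^ (m + 1) * (1 - q ^ (2 * m + 3))`, and comparing the two
gives `(1 - q) H_0(w) = (1 + w) ∑ m, c_m w ^ m`.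

Since `S_{-2k-2} = -S_{2k}`, the binomial sum folds into one with coefficients
`C(2N+1, N+m+1) - C(2N+1, N+m+2)`, which are the ballot numbers of the formula. No step divides by
`1 - q ^ n` with `n > 1`, so roots of unity need no separate treatment.
-/

/-! ### Path diagrams as weighted lattice paths -/

section Paths

open DyckStep

/-- The step lists of the lattice paths of length `n` from height `h` to height `0` that never go
below height `0`. -/
def pathsToZero : ℕ → ℕ → Finset (List DyckStep)
  | 0, 0 => {[]}
  | 0, _ + 1 => ∅
  | n + 1, 0 => (pathsToZero n 1).image (List.cons U)
  | n + 1, h + 1 =>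
    (pathsToZero n (h + 2)).image (List.cons U) ∪ (pathsToZero n h).image (List.cons D)

theorem forall_take_cons {P : List DyckStep → Prop} {s : DyckStep} {l : List DyckStep} :
    (∀ i, P ((s :: l).take i)) ↔ P [] ∧ ∀ i, P (s :: l.take i) := by
  refine ⟨fun H => ⟨by simpa using H 0, fun i => by simpa using H (i + 1)⟩, fun H i => ?_⟩
  rcases i with _ | i
  · simpa using H.1
  · simpa using H.2 i

theorem mem_pathsToZero {n h : ℕ} {l : List DyckStep} :
    l ∈ pathsToZero n h ↔ l.length = n ∧ h + l.count U = l.count D ∧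
      ∀ i, (l.take i).count D ≤ h + (l.take i).count U := by
  induction l generalizing n h with
  | nil => rcases n with _ | n <;> rcases h with _ | h <;> simp [pathsToZero]
  | cons s l ih =>
    rw [forall_take_cons (P := fun m => m.count D ≤ h + m.count U)]
    rcases s with _ | _
    · have e : (∀ i, (U :: l.take i).count D ≤ h + (U :: l.take i).count U) ↔
          ∀ i, (l.take i).count D ≤ h + 1 + (l.take i).count U :=
        forall_congr' fun i => by simp; omega
      have e' : h + (U :: l).count U = (U :: l).count D ↔ h + 1 + l.count U = l.count D := by
        simp; omega
      rw [e, e']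
      rcases n with _ | n <;> rcases h with _ | h <;> simp [pathsToZero, ih]
    · rcases h with _ | h
      · have : ¬ ∀ i, (D :: l.take i).count D ≤ 0 + (D :: l.take i).count U := fun H => by
          simpa using H 0
        rcases n with _ | n
        · simp [pathsToZero]
        · simp only [this, and_false]
          simp [pathsToZero]
      · have e : (∀ i, (D :: l.take i).count D ≤ h + 1 + (D :: l.take i).count U) ↔
            ∀ i, (l.take i).count D ≤ h + (l.take i).count U :=
          forall_congr' fun i => by simp; omega
        have e' : h + 1 + (D :: l).count U = (D :: l).count D ↔ h + l.count U = l.count D := by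
          simp; omega
        rw [e, e']
        rcases n with _ | n <;> simp [pathsToZero, ih]

variable {K : Type*} [CommRing K] (q : K)

/-- The product, over the steps of a path that starts at height `h`, of the `q`-integers
`1 + q + ⋯ + q ^ a`, where `a` is the starting height of the step. -/
def pathWeight : ℕ → List DyckStep → K
  | _, [] => 1
  | h, U :: l => (∑ s ∈ Finset.range (h + 1), q ^ s) * pathWeight (h + 1) l
  | h, D :: l => (∑ s ∈ Finset.range (h + 1), q ^ s) * pathWeight (h - 1) l

theorem pathWeight_eq_prod (h : ℕ) (l : List DyckStep)
    (hl : ∀ i, (l.take i).count D ≤ h + (l.take i).count U) :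
    pathWeight q h l = ∏ i : Fin l.length,
      ∑ s ∈ Finset.range (h + (l.take i).count U - (l.take i).count D + 1), q ^ s := by
  induction l generalizing h with
  | nil => simp [pathWeight]
  | cons s l ih =>
    rw [forall_take_cons (P := fun m => m.count D ≤ h + m.count U)] at hl
    rcases s with _ | _
    · rw [pathWeight, ih (h + 1) fun i => by have := hl.2 i; simp at this; omega]
      simp only [List.length_cons]
      rw [Fin.prod_univ_succ]
      simp [add_comm, add_left_comm]
    · have h1 : 1 ≤ h := by simpa using hl.2 0
      rw [pathWeight, ih (h - 1) fun i => by have := hl.2 i; simp at this; omega]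
      simp only [List.length_cons]
      rw [Fin.prod_univ_succ]
      congr 1
      refine Finset.prod_congr rfl fun i _ => Finset.sum_congr ?_ fun _ _ => rfl
      congr 1
      simp
      omega

/-- The total weight of the paths of length `n` from height `h` to height `0`. -/
def pathSum (n h : ℕ) : K := ∑ l ∈ pathsToZero n h, pathWeight q h l

theorem pathSum_zero : pathSum q 0 = Pi.single 0 1 := by
  funext h
  rcases h with _ | h <;> simp [pathSum, pathsToZero, pathWeight]

theorem pathSum_succ_zero (n : ℕ) : pathSum q (n + 1) 0 = pathSum q n 1 := by
  rw [pathSum, pathsToZero, Finset.sum_image (by simp)]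
  simp [pathWeight, pathSum]

theorem pathSum_succ_succ (n h : ℕ) :
    pathSum q (n + 1) (h + 1) =
      (∑ s ∈ Finset.range (h + 2), q ^ s) * (pathSum q n (h + 2) + pathSum q n h) := by
  rw [pathSum, pathsToZero, Finset.sum_union, Finset.sum_image (by simp),
    Finset.sum_image (by simp)]
  · simp [pathWeight, pathSum, mul_add, Finset.mul_sum]
  · rw [Finset.disjoint_left]
    simp

/-- The column heights of a path diagram are chosen independently, so each step contributes a
`q`-integer. -/
theorem sum_pow_heightSum (N : ℕ) :
    ∑ d : PathDiagram tangentPos N, q ^ d.heightSum = pathSum q (2 * N) 0 := by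
  have h₁ : ∑ d : PathDiagram tangentPos N, q ^ d.heightSum =
      ∑ p : {p : DyckWord // p.semilength = N}, pathWeight q 0 p.1.toList := by
    change ∑ d : (Σ p : {p : DyckWord // p.semilength = N},
      ((i : Fin p.1.toList.length) →
        Fin (tangentPos (p.1.toList.get i) (p.1.startHeight i) + 1))),
      q ^ (∑ i, (d.2 i : ℕ)) = _
    rw [Fintype.sum_sigma]
    refine Finset.sum_congr rfl fun p _ => ?_
    rw [pathWeight_eq_prod q 0 _ fun i => by simpa using p.1.count_D_le_count_U i]
    simp only [← Finset.prod_pow_eq_pow_sum]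
    rw [← Fintype.prod_sum fun (i : Fin p.1.toList.length)
      (s : Fin (tangentPos (p.1.toList.get i) (p.1.startHeight i) + 1)) => q ^ (s : ℕ)]
    refine Finset.prod_congr rfl fun i _ => ?_
    rw [Fin.sum_univ_eq_sum_range (fun s => q ^ s)]
    simp [tangentPos, DyckWord.startHeight]
  rw [h₁, pathSum]
  refine Finset.sum_bij (fun p _ => p.1.toList) ?_ ?_ ?_ ?_
  · intro p _
    refine mem_pathsToZero.2 ⟨?_, by simpa using p.1.count_U_eq_count_D,
      fun i => by simpa using p.1.count_D_le_count_U i⟩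
    rw [← p.1.two_mul_semilength_eq_length, p.2]
  · intro p _ p' _ h
    exact Subtype.ext (DyckWord.ext h)
  · intro l hl
    obtain ⟨hlen, hc, ht⟩ := mem_pathsToZero.1 hl
    refine ⟨⟨⟨l, by simpa using hc, fun i => by simpa using ht i⟩, ?_⟩, Finset.mem_univ _, rfl⟩
    have := DyckWord.two_mul_semilength_eq_length
      (p := ⟨l, by simpa using hc, fun i => by simpa using ht i⟩)
    simp only [hlen] at this
    omega
  · intro p _
    rfl

theorem eval₂_pathDiagramPoly (pos : PossibilityFunction) (N : ℕ) :
    (pathDiagramPoly pos N).eval₂ (Int.castRingHom K) q =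
      ∑ d : PathDiagram pos N, q ^ d.heightSum := by
  have : pathDiagramPoly pos N =
      ∑ d : PathDiagram pos N, (Polynomial.X : ℤ[X]) ^ d.heightSum := by
    ext m
    rw [coeff_pathDiagramPoly, Polynomial.finsetSum_coeff]
    simp only [Polynomial.coeff_X_pow, Finset.sum_boole, numPathDiagrams, Fintype.card_subtype,
      eq_comm]
  simp [this, Polynomial.eval₂_finsetSum]

theorem coeff_tangentGF (N : ℕ) :
    PowerSeries.coeff (2 * N) (tangentGF q) = pathSum q (2 * N) 0 := by
  simp [tangentGF, pathDiagramSeries, eval₂_pathDiagramPoly, sum_pow_heightSum]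

end Paths

/-! ### Chebyshev vectors of the tridiagonal operator -/

/-- The operator `f ↦ (h ↦ (1 - q ^ (h + 1)) * (f (h - 1) + f (h + 1)))` on sequences, with
`f (-1) = 0`. It is the transfer operator of Dyck paths in which a step from height `h` has weight
`1 - q ^ (h + 1)`. -/
def stepOp {K : Type*} [CommRing K] (q : K) : Module.End K (ℕ → K) where
  toFun f h := (1 - q ^ (h + 1)) * (f (h + 1) + match h with
    | 0 => 0
    | k + 1 => f k)
  map_add' f g := by
    funext h
    cases h <;> simp <;> ring
  map_smul' c f := by
    funext h
    cases h <;> simp <;> ring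

section Chebyshev

variable {K : Type*} [CommRing K] (q : K)

theorem stepOp_apply_zero (f : ℕ → K) : stepOp q f 0 = (1 - q) * f 1 := by
  simp [stepOp]

theorem stepOp_apply_succ (f : ℕ → K) (h : ℕ) :
    stepOp q f (h + 1) = (1 - q ^ (h + 2)) * (f (h + 2) + f h) := by
  simp [stepOp]

/-- The vector `S_k(X) e₀`, where `X` is `stepOp q`, `e₀` is the indicator of height `0`, and `S_k`
is the rescaled Chebyshev polynomial of the second kind, `S_k(z + 1/z) = (z^(k+1) - z^(-k-1)) /
(z - 1/z)`, for every integer `k`. -/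
noncomputable def chebVec (k : ℤ) : ℕ → K :=
  Polynomial.aeval (stepOp q) (Polynomial.Chebyshev.S K k) (Pi.single 0 1)

theorem chebVec_zero : chebVec q 0 = Pi.single 0 1 := by
  simp [chebVec]

theorem chebVec_neg_one : chebVec q (-1) = 0 := by
  simp [chebVec]

theorem chebVec_neg_sub_two (k : ℤ) : chebVec q (-k - 2) = -chebVec q k := by
  simp [chebVec, Polynomial.Chebyshev.S_neg_sub_two]

theorem stepOp_chebVec (k : ℤ) :
    stepOp q (chebVec q k) = chebVec q (k + 1) + chebVec q (k - 1) := by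
  simp [chebVec, Polynomial.Chebyshev.S_add_one]

theorem chebVec_add_one (k : ℤ) :
    chebVec q (k + 1) = stepOp q (chebVec q k) - chebVec q (k - 1) := by
  rw [stepOp_chebVec]; abel

/-- `S_k(X) e₀` is supported on heights at most `k`. -/
theorem chebVec_apply_of_lt (k : ℕ) : ∀ h : ℕ, k ≤ h → chebVec q ((k : ℤ) - 1) h = 0 := by
  induction k using Nat.twoStepInduction with
  | zero => intro h _; simp [chebVec_neg_one]
  | one =>
    intro h hh
    obtain ⟨h, rfl⟩ := Nat.exists_eq_add_of_le' hh
    simp [chebVec_zero]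
  | more k ih₁ ih₂ =>
    intro h hh
    obtain ⟨h, rfl⟩ := Nat.exists_eq_add_of_le' (show 1 ≤ h by omega)
    have e₁ : ((k + 2 : ℕ) : ℤ) - 1 = (k : ℤ) + 1 := by push_cast; ring
    have e₂ : ((k + 1 : ℕ) : ℤ) - 1 = (k : ℤ) := by push_cast; ring
    rw [e₂] at ih₂
    rw [e₁, chebVec_add_one, Pi.sub_apply, stepOp_apply_succ, ih₂ _ (by omega), ih₂ _ (by omega),
      ih₁ _ (by omega)]
    simp

/-- Powers of `X` in the Chebyshev basis; with integer indices the expansion of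
`(z + 1/z) ^ n` is the binomial theorem. -/
theorem stepOp_pow_single (n : ℕ) :
    (stepOp q ^ n) (Pi.single 0 1) =
      ∑ j ∈ Finset.range (n + 1), (n.choose j : K) • chebVec q ((n : ℤ) - 2 * j) := by
  induction n with
  | zero => simp [chebVec_zero]
  | succ n ih =>
    have h₁ : ∑ j ∈ Finset.range (n + 1), (n.choose j : K) • chebVec q ((n : ℤ) - 2 * j + 1) =
        chebVec q (n + 1) + ∑ j ∈ Finset.range (n + 1),
          (n.choose (j + 1) : K) • chebVec q ((n : ℤ) - 2 * j - 1) := by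
      rw [Finset.sum_range_succ' _ n, Finset.sum_range_succ _ n]
      simp only [Nat.choose_succ_self, Nat.cast_zero, zero_smul, add_zero, Nat.choose_zero_right,
        Nat.cast_one, one_smul, mul_zero, sub_zero]
      rw [add_comm]
      congr 1
      refine Finset.sum_congr rfl fun j _ => ?_
      congr 2
      push_cast
      ring
    rw [pow_succ', Module.End.mul_apply, ih, map_sum]
    simp only [map_smul, stepOp_chebVec, smul_add, Finset.sum_add_distrib]
    rw [h₁, Finset.sum_range_succ' _ (n + 1), add_assoc, ← Finset.sum_add_distrib, add_comm]
    congr 1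
    · refine Finset.sum_congr rfl fun j _ => ?_
      rw [← add_smul, Nat.choose_succ_succ]
      congr 1
      · push_cast; ring
      · congr 1; push_cast; ring
    · simp

end Chebyshev

/-! ### The `q`-difference equation -/

section QDifference

variable {K : Type*} [CommRing K] (q : K)

/-- The generating function `∑ n, S_{2n+h}(X) e₀ (h) * w ^ n`. -/
noncomputable def chebSeries (h : ℕ) : K⟦X⟧ :=
  PowerSeries.mk fun n => chebVec q (2 * (n : ℤ) + h) h

local notation "w" => (PowerSeries.X : K⟦X⟧)
local notation "Q" => (PowerSeries.C q : K⟦X⟧)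

theorem chebSeries_zero_eq :
    (1 + w) * chebSeries q 0 = 1 + (1 - Q) * (w * chebSeries q 1) := by
  have hC : (1 - Q) = PowerSeries.C (1 - q) := by simp
  rw [hC]
  ext n
  rcases n with _ | n
  · simp [chebSeries, chebVec_zero]
  · rw [add_mul, one_mul, map_add, map_add, PowerSeries.coeff_C_mul, PowerSeries.coeff_succ_X_mul,
      PowerSeries.coeff_succ_X_mul]
    simp only [chebSeries, PowerSeries.coeff_mk, PowerSeries.coeff_one]
    have := congrFun (stepOp_chebVec q (2 * (n : ℤ) + 1)) 0
    rw [stepOp_apply_zero, Pi.add_apply] at this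
    have e₁ : 2 * (n : ℤ) + 1 + 1 = 2 * ((n + 1 : ℕ) : ℤ) + (0 : ℕ) := by push_cast; ring
    have e₂ : 2 * (n : ℤ) + 1 - 1 = 2 * (n : ℤ) + (0 : ℕ) := by push_cast; ring
    rw [e₁, e₂] at this
    simpa using this.symm

theorem chebSeries_succ_eq (h : ℕ) :
    (1 + w) * chebSeries q (h + 1) =
      (1 - Q ^ (h + 2)) * (chebSeries q h + w * chebSeries q (h + 2)) := by
  have hC : (1 - Q ^ (h + 2)) = PowerSeries.C (1 - q ^ (h + 2)) := by simp
  rw [hC]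
  ext n
  rw [add_mul, one_mul, map_add, PowerSeries.coeff_C_mul, map_add]
  rcases n with _ | n
  · simp only [chebSeries, PowerSeries.coeff_zero_X_mul, PowerSeries.coeff_mk]
    have := congrFun (stepOp_chebVec q (h : ℤ)) (h + 1)
    have z₁ := chebVec_apply_of_lt q (h + 1) (h + 2) (by omega)
    have z₂ := chebVec_apply_of_lt q h (h + 1) (by omega)
    rw [stepOp_apply_succ, Pi.add_apply, z₂] at this
    have e₁ : ((h + 1 : ℕ) : ℤ) - 1 = h := by push_cast; ring
    rw [e₁] at z₁
    rw [z₁] at this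
    simpa using this.symm
  · rw [PowerSeries.coeff_succ_X_mul, PowerSeries.coeff_succ_X_mul]
    simp only [chebSeries, PowerSeries.coeff_mk]
    have := congrFun (stepOp_chebVec q (2 * ((n + 1 : ℕ) : ℤ) + h)) (h + 1)
    rw [stepOp_apply_succ, Pi.add_apply] at this
    have e₁ : 2 * ((n + 1 : ℕ) : ℤ) + h + 1 = 2 * ((n + 1 : ℕ) : ℤ) + (h + 1 : ℕ) := by
      push_cast; ring
    have e₂ : 2 * ((n + 1 : ℕ) : ℤ) + h - 1 = 2 * (n : ℤ) + (h + 1 : ℕ) := by push_cast; ring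
    have e₃ : 2 * (n : ℤ) + (h + 2 : ℕ) = 2 * ((n + 1 : ℕ) : ℤ) + h := by push_cast; ring
    rw [e₁, e₂] at this
    rw [← this, e₃]
    ring

/-- The dilation `w ↦ q ^ 2 * w`. -/
noncomputable def dilate : K⟦X⟧ →+* K⟦X⟧ := PowerSeries.rescale (q ^ 2)

theorem dilate_X : dilate q w = Q ^ 2 * w := by
  simp [dilate, PowerSeries.rescale_X]

theorem dilate_C (a : K) : dilate q (PowerSeries.C a) = PowerSeries.C a := by
  ext n
  rw [dilate, PowerSeries.coeff_rescale, PowerSeries.coeff_C]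
  split_ifs with h <;> simp [h]

theorem coeff_dilate (f : K⟦X⟧) (n : ℕ) :
    PowerSeries.coeff n (dilate q f) = q ^ (2 * n) * PowerSeries.coeff n f := by
  rw [dilate, PowerSeries.coeff_rescale, pow_mul]

theorem dilate_chebSeries_zero_eq :
    (1 + Q ^ 2 * w) * dilate q (chebSeries q 0) =
      1 + (1 - Q) * (Q ^ 2 * w * dilate q (chebSeries q 1)) := by
  simpa [dilate_X, dilate_C] using congrArg (dilate q) (chebSeries_zero_eq q)

theorem dilate_chebSeries_succ_eq (h : ℕ) :
    (1 + Q ^ 2 * w) * dilate q (chebSeries q (h + 1)) =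
      (1 - Q ^ (h + 2)) * (dilate q (chebSeries q h) +
        Q ^ 2 * w * dilate q (chebSeries q (h + 2))) := by
  simpa [dilate_X, dilate_C] using congrArg (dilate q) (chebSeries_succ_eq q h)

/-- The defect in the contiguity relation between the series `chebSeries q h`, their neighbours
`chebSeries q (h - 1)` and the dilations of both. With `H(y) = ∑ h, chebSeries q h * (w * y) ^ h` it
is the coefficient of `(w * y) ^ h` in the difference of the two sides of
`(1 + q² w) (1 - y w) H(y, w) = q³ w (1 + w) (1 - y / q) H(y / q, q² w) + 1 - q w`. -/
noncomputable def contiguityDefect : ℕ → K⟦X⟧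
  | 0 => (1 + Q ^ 2 * w) * chebSeries q 0 -
      Q ^ 3 * w * (1 + w) * dilate q (chebSeries q 0) - (1 - Q * w)
  | h + 1 => (1 + Q ^ 2 * w) * (chebSeries q (h + 1) - chebSeries q h) -
      Q ^ (h + 2) * (1 + w) *
        (Q ^ 2 * w * dilate q (chebSeries q (h + 1)) - dilate q (chebSeries q h))

theorem contiguityDefect_zero_eq :
    (1 + Q * w) * contiguityDefect q 0 = (1 - Q) * (w * contiguityDefect q 1) := by
  simp only [contiguityDefect]
  linear_combination (1 + Q ^ 2 * w) * chebSeries_zero_eq q -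
    Q ^ 2 * w * (1 + w) * dilate_chebSeries_zero_eq q

theorem contiguityDefect_succ_eq (h : ℕ) :
    (1 + Q * w) * contiguityDefect q (h + 1) =
      (1 - Q ^ (h + 2)) * (w * contiguityDefect q (h + 2)) +
        Q * (1 - Q ^ (h + 1)) * contiguityDefect q h := by
  rcases h with _ | h
  · simp only [contiguityDefect]
    linear_combination (1 + Q ^ 2 * w) * chebSeries_succ_eq q 0 -
      Q * (1 + Q ^ 2 * w) * chebSeries_zero_eq q -
      Q ^ 3 * w * (1 + w) * dilate_chebSeries_succ_eq q 0 +
      Q ^ 2 * (1 + w) * dilate_chebSeries_zero_eq q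
  · simp only [contiguityDefect]
    linear_combination (1 + Q ^ 2 * w) * chebSeries_succ_eq q (h + 1) -
      Q * (1 + Q ^ 2 * w) * chebSeries_succ_eq q h -
      Q ^ (h + 4) * w * (1 + w) * dilate_chebSeries_succ_eq q (h + 1) +
      Q ^ (h + 3) * (1 + w) * dilate_chebSeries_succ_eq q h

/-- The defects satisfy a homogeneous recursion that determines the coefficient of `w ^ n` from
coefficients of lower powers of `w` and from lower `h`, so they vanish. -/
theorem contiguityDefect_eq_zero (h : ℕ) : contiguityDefect q h = 0 := by
  suffices H : ∀ n h, PowerSeries.coeff n (contiguityDefect q h) = 0 by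
    ext n; simp [H]
  have hC : ∀ k, (1 - Q ^ k) = PowerSeries.C (1 - q ^ k) := fun k => by simp
  have hC₁ : (1 - Q) = PowerSeries.C (1 - q) := by simp
  intro n
  induction n with
  | zero =>
    intro h
    induction h with
    | zero =>
      have := congrArg (PowerSeries.coeff 0) (contiguityDefect_zero_eq q)
      simpa using this
    | succ h ih =>
      have := congrArg (PowerSeries.coeff 0) (contiguityDefect_succ_eq q h)
      simp only [PowerSeries.coeff_zero_eq_constantCoeff] at ih
      simpa [ih] using this
  | succ n ihn =>
    intro h
    induction h with
    | zero =>
      have := congrArg (PowerSeries.coeff (n + 1)) (contiguityDefect_zero_eq q)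
      rw [hC₁, add_mul, one_mul, mul_assoc, map_add, PowerSeries.coeff_C_mul,
        PowerSeries.coeff_C_mul, PowerSeries.coeff_succ_X_mul, PowerSeries.coeff_succ_X_mul, ihn,
        ihn] at this
      simpa using this
    | succ h ih =>
      have := congrArg (PowerSeries.coeff (n + 1)) (contiguityDefect_succ_eq q h)
      rw [hC, hC, add_mul, one_mul, mul_assoc, mul_assoc, map_add, map_add, PowerSeries.coeff_C_mul,
        PowerSeries.coeff_C_mul, PowerSeries.coeff_C_mul, PowerSeries.coeff_C_mul,
        PowerSeries.coeff_succ_X_mul, PowerSeries.coeff_succ_X_mul, ihn, ihn, ih] at this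
      simpa using this

theorem chebSeries_zero_qDifference :
    (1 + Q ^ 2 * w) * chebSeries q 0 =
      Q ^ 3 * w * (1 + w) * dilate q (chebSeries q 0) + (1 - Q * w) := by
  have := contiguityDefect_eq_zero q 0
  rw [contiguityDefect] at this
  linear_combination this

/-- A homogeneous `q`-difference equation with only the zero solution. -/
theorem eq_zero_of_qDifference {E : K⟦X⟧}
    (hE : (1 + Q ^ 2 * w) * E = w * (Q ^ 3 * ((1 + w) * dilate q E))) : E = 0 := by
  have key : ∀ n, PowerSeries.coeff n E = 0 ∧ PowerSeries.coeff (n + 1) E = 0 := by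
    have hQ : ∀ k, Q ^ k = PowerSeries.C (q ^ k) := fun k => by simp
    rw [hQ, hQ, add_mul, one_mul, mul_assoc, add_mul, one_mul] at hE
    have h0 : PowerSeries.coeff 0 E = 0 := by
      simpa using congrArg (PowerSeries.coeff 0) hE
    have hs : ∀ n, PowerSeries.coeff (n + 1) E + q ^ 2 * PowerSeries.coeff n E =
        q ^ 3 * (q ^ (2 * n) * PowerSeries.coeff n E +
          PowerSeries.coeff n (w * dilate q E)) := fun n => by
      have := congrArg (PowerSeries.coeff (n + 1)) hE
      rwa [map_add, PowerSeries.coeff_C_mul, PowerSeries.coeff_succ_X_mul,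
        PowerSeries.coeff_succ_X_mul, PowerSeries.coeff_C_mul, map_add, coeff_dilate] at this
    intro n
    induction n with
    | zero =>
      refine ⟨h0, ?_⟩
      have := hs 0
      rw [h0, PowerSeries.coeff_zero_X_mul] at this
      simpa using this
    | succ n ih =>
      refine ⟨ih.2, ?_⟩
      have := hs (n + 1)
      rw [ih.2, PowerSeries.coeff_succ_X_mul, coeff_dilate, ih.1] at this
      simpa using this
  ext n
  simpa using (key n).1

/-- Any sequence with the first-order recursion of the partial theta sums generates the Chebyshev
coefficients, up to the factors `1 - q` and `1 + w`. -/
theorem chebSeries_zero_eq_of_recursion {c : ℕ → K} (h0 : c 0 = 1 - q)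
    (hs : ∀ m, c (m + 1) = q ^ (2 * m + 3) * c m + (-1) ^ (m + 1) * (1 - q ^ (2 * m + 3))) :
    (1 - Q) * chebSeries q 0 = (1 + w) * PowerSeries.mk c := by
  have hJ : (1 + w) * PowerSeries.mk (fun n => (-1 : K) ^ n) = 1 := by
    ext n
    rw [add_mul, one_mul, map_add]
    rcases n with _ | n
    · simp
    · rw [PowerSeries.coeff_succ_X_mul]
      simp [pow_succ, PowerSeries.coeff_one]
  have hJ' := congrArg (dilate q) hJ
  simp only [map_mul, map_add, map_one, dilate_X] at hJ'
  set J : K⟦X⟧ := PowerSeries.mk fun n => (-1 : K) ^ n with hJdef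
  have hc : PowerSeries.mk c = w * (Q ^ 3 * dilate q (PowerSeries.mk c)) + J - Q * dilate q J := by
    have hQ : Q ^ 3 = PowerSeries.C (q ^ 3) := by simp
    rw [hQ]
    ext n
    rw [map_sub, map_add, PowerSeries.coeff_C_mul, coeff_dilate]
    rcases n with _ | n
    · simp [hJdef, h0]
    · rw [PowerSeries.coeff_succ_X_mul, PowerSeries.coeff_C_mul, coeff_dilate]
      simp only [hJdef, PowerSeries.coeff_mk, hs]
      ring
  rw [← sub_eq_zero]
  apply eq_zero_of_qDifference q
  simp only [map_sub, map_mul, map_add, map_one, dilate_C, dilate_X]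
  linear_combination (1 - Q) * chebSeries_zero_qDifference q -
    (1 + w) * (1 + Q ^ 2 * w) * hc - (1 + Q ^ 2 * w) * hJ + Q * (1 + w) * hJ'

end QDifference

/-! ### Partial theta sums and ballot numbers -/

section Closing

/-- The path sums are, up to a power of `1 - q`, the vectors `X ^ n e₀`. -/
theorem stepOp_pow_eq_pathSum {K : Type*} [CommRing K] (q : K) (n : ℕ) :
    (stepOp q ^ n) (Pi.single 0 1) = (1 - q) ^ n • pathSum q n := by
  induction n with
  | zero => simp [pathSum_zero]
  | succ n ih =>
    rw [pow_succ', Module.End.mul_apply, ih, map_smul]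
    funext h
    rcases h with _ | h
    · simp only [Pi.smul_apply, stepOp_apply_zero, pathSum_succ_zero, smul_eq_mul]
      ring
    · simp only [Pi.smul_apply, stepOp_apply_succ, pathSum_succ_succ, smul_eq_mul]
      rw [← mul_neg_geom_sum q (h + 2)]
      ring

/-- Abel summation with step two. -/
theorem sum_mul_sub_eq_sum_sub_mul {K : Type*} [CommRing K] (g c : ℕ → K) (hc : c 0 = 0)
    (n : ℕ) :
    g 0 * c 1 + ∑ k ∈ Finset.range n, g (k + 1) * (c (k + 2) - c k) =
      ∑ m ∈ Finset.range n, (g m - g (m + 2)) * c (m + 1) + g n * c (n + 1) +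
        g (n + 1) * c n := by
  induction n with
  | zero => simp [hc]
  | succ n ih =>
    rw [Finset.sum_range_succ, Finset.sum_range_succ]
    linear_combination ih

/-- Folding a sum over a row of Pascal's triangle at its centre. -/
theorem sum_choose_mul_eq_fold {K : Type*} [CommRing K] (f : ℤ → K) (N : ℕ) :
    ∑ j ∈ Finset.range (2 * N + 1), ((2 * N).choose j : K) * f ((N : ℤ) - j) =
      ((2 * N).choose N : K) * f 0 +
        ∑ k ∈ Finset.range N,
          ((2 * N).choose (N + (k + 1)) : K) * (f ((k + 1 : ℕ) : ℤ) + f (-((k + 1 : ℕ) : ℤ))) := by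
  have h₁ : ∑ j ∈ Finset.range N, ((2 * N).choose j : K) * f ((N : ℤ) - j) =
      ∑ k ∈ Finset.range N, ((2 * N).choose (N + (k + 1)) : K) * f ((k + 1 : ℕ) : ℤ) := by
    rw [← Finset.sum_range_reflect]
    refine Finset.sum_congr rfl fun k hk => ?_
    have hk := Finset.mem_range.1 hk
    rw [Nat.choose_symm_of_eq_add (by omega : 2 * N = (N - 1 - k) + (N + (k + 1)))]
    congr 2
    omega
  have h₂ : ∑ j ∈ Finset.range (N + 1),
      ((2 * N).choose (N + j) : K) * f ((N : ℤ) - ((N + j : ℕ) : ℤ)) =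
      ∑ k ∈ Finset.range N, ((2 * N).choose (N + (k + 1)) : K) * f (-((k + 1 : ℕ) : ℤ)) +
        ((2 * N).choose N : K) * f 0 := by
    rw [Finset.sum_range_succ']
    congr 1
    · refine Finset.sum_congr rfl fun k _ => ?_
      congr 2
      push_cast
      ring
    · simp
  rw [show 2 * N + 1 = N + (N + 1) by ring, Finset.sum_range_add, h₁, h₂]
  simp only [mul_add, Finset.sum_add_distrib]
  ring

/-- The sums `q ^ (m ^ 2 + 2 * m) * ∑ l, (-1) ^ l * q ^ (-l ^ 2 + 2 * l)` over
`-m ≤ l ≤ m + 1`. -/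
noncomputable def partialTheta {K : Type*} [Field K] (q : K) (m : ℕ) : K :=
  q ^ (m ^ 2 + 2 * m) *
    ∑ l ∈ Finset.Icc (-(m : ℤ)) ((m : ℤ) + 1), (-1 : K) ^ l * q ^ (-l ^ 2 + 2 * l)

variable {K : Type*} [Field K] {q : K}

theorem partialTheta_zero (q : K) : partialTheta q 0 = 1 - q := by
  have : Finset.Icc (0 : ℤ) 1 = {0, 1} := by decide
  simp [partialTheta, this]
  ring

theorem partialTheta_succ (hq : q ≠ 0) (m : ℕ) :
    partialTheta q (m + 1) =
      q ^ (2 * m + 3) * partialTheta q m + (-1) ^ (m + 1) * (1 - q ^ (2 * m + 3)) := by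
  have hI : Finset.Icc (-((m + 1 : ℕ) : ℤ)) (((m + 1 : ℕ) : ℤ) + 1) =
      insert (-((m + 1 : ℕ) : ℤ)) (insert (((m + 1 : ℕ) : ℤ) + 1)
        (Finset.Icc (-(m : ℤ)) ((m : ℤ) + 1))) := by
    ext x
    simp only [Finset.mem_Icc, Finset.mem_insert]
    push_cast
    omega
  rw [partialTheta, hI, Finset.sum_insert, Finset.sum_insert, partialTheta]
  · have e₁ : q ^ ((m + 1) ^ 2 + 2 * (m + 1)) *
        q ^ (-(-((m + 1 : ℕ) : ℤ)) ^ 2 + 2 * (-((m + 1 : ℕ) : ℤ))) = 1 := by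
      rw [← zpow_natCast, ← zpow_add₀ hq, ← zpow_zero q]
      congr 1; push_cast; ring
    have e₂ : q ^ ((m + 1) ^ 2 + 2 * (m + 1)) *
        q ^ (-(((m + 1 : ℕ) : ℤ) + 1) ^ 2 + 2 * (((m + 1 : ℕ) : ℤ) + 1)) = q ^ (2 * m + 3) := by
      rw [← zpow_natCast, ← zpow_add₀ hq, ← zpow_natCast]
      congr 1; push_cast; ring
    have s₁ : (-1 : K) ^ (-((m + 1 : ℕ) : ℤ)) = (-1) ^ (m + 1) := by
      rw [zpow_neg, zpow_natCast, ← inv_pow, inv_neg_one]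
    have s₂ : (-1 : K) ^ (((m + 1 : ℕ) : ℤ) + 1) = -(-1) ^ (m + 1) := by
      rw [zpow_add₀ (by simp), zpow_natCast]; simp
    rw [s₁, s₂]
    linear_combination (-1) ^ (m + 1) * e₁ - (-1) ^ (m + 1) * e₂
  · simp only [Finset.mem_Icc]
    omega
  · simp only [Finset.mem_Icc, Finset.mem_insert]
    push_cast
    omega

theorem one_sub_mul_chebVec_zero (q : K) :
    (1 - q) * chebVec q 0 0 = partialTheta q 0 := by
  simp [chebVec_zero, partialTheta_zero q]

theorem one_sub_mul_chebVec_succ (hq : q ≠ 0) (n : ℕ) :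
    (1 - q) * chebVec q (2 * ((n + 1 : ℕ) : ℤ)) 0 =
      partialTheta q (n + 1) + partialTheta q n := by
  have h := congrArg (PowerSeries.coeff (n + 1))
    (chebSeries_zero_eq_of_recursion q (partialTheta_zero q) (partialTheta_succ hq))
  have hC : (1 - PowerSeries.C q) = PowerSeries.C (1 - q) := by simp
  rw [hC, PowerSeries.coeff_C_mul, add_mul, one_mul, map_add, PowerSeries.coeff_succ_X_mul] at h
  simpa [chebSeries] using h

theorem chebVec_neg_succ (n : ℕ) :
    chebVec q (2 * -((n + 1 : ℕ) : ℤ)) = -chebVec q (2 * (n : ℤ)) := by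
  rw [← chebVec_neg_sub_two]
  congr 1
  push_cast
  ring

/-- Folding uses `S_{-2k-2} = -S_{2k}`; the differences telescope. -/
theorem one_sub_mul_stepOp_pow (hq : q ≠ 0) (N : ℕ) :
    (1 - q) * (stepOp q ^ (2 * N)) (Pi.single 0 1) 0 =
      ∑ m ∈ Finset.range (N + 1),
        (((2 * N + 1).choose (N + m + 1) : K) - ((2 * N + 1).choose (N + m + 2) : K)) *
          partialTheta q m := by
  have h₁ : (1 - q) * (stepOp q ^ (2 * N)) (Pi.single 0 1) 0 =
      ∑ j ∈ Finset.range (2 * N + 1), ((2 * N).choose j : K) *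
        ((1 - q) * chebVec q (2 * ((N : ℤ) - j)) 0) := by
    rw [stepOp_pow_single, Finset.sum_apply, Finset.mul_sum]
    refine Finset.sum_congr rfl fun j _ => ?_
    rw [Pi.smul_apply, smul_eq_mul, mul_left_comm]
    congr 4
    push_cast
    ring
  -- `c` is `partialTheta q` shifted by one, with value `0` at `m = -1`.
  set c : ℕ → K := fun m => if m = 0 then 0 else partialTheta q (m - 1) with hc
  have hf : ∀ k : ℕ, (1 - q) * chebVec q (2 * (k : ℤ)) 0 = c (k + 1) + c k := fun k => by
    rcases k with _ | k
    · simpa [hc] using one_sub_mul_chebVec_zero q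
    · simpa [hc] using one_sub_mul_chebVec_succ hq k
  have hg : ∀ m : ℕ, ((2 * N + 1).choose (N + m + 1) : K) - ((2 * N + 1).choose (N + m + 2) : K) =
      ((2 * N).choose (N + m) : K) - ((2 * N).choose (N + (m + 2)) : K) := fun m => by
    rw [Nat.choose_succ_succ, show N + m + 2 = N + m + 1 + 1 by ring, Nat.choose_succ_succ,
      show N + (m + 2) = N + m + 1 + 1 by ring]
    push_cast
    ring
  have h₂ := sum_mul_sub_eq_sum_sub_mul (fun m => ((2 * N).choose (N + m) : K)) c (by simp [hc]) N
  have z₁ : (2 * N).choose (N + (N + 1)) = 0 := Nat.choose_eq_zero_of_lt (by omega)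
  have z₂ : (2 * N).choose (N + (N + 2)) = 0 := Nat.choose_eq_zero_of_lt (by omega)
  have h₃ : ∀ k : ℕ, (1 - q) * chebVec q (2 * ((k + 1 : ℕ) : ℤ)) 0 +
      (1 - q) * chebVec q (2 * -((k + 1 : ℕ) : ℤ)) 0 = c (k + 2) - c k := fun k => by
    rw [chebVec_neg_succ, Pi.neg_apply, mul_neg, hf, hf]
    ring
  rw [h₁, sum_choose_mul_eq_fold fun k => (1 - q) * chebVec q (2 * k) 0, Finset.sum_range_succ]
  simp only [h₃, hg]
  have h₀ : (1 - q) * chebVec q (2 * 0) 0 = c 1 := by simpa [hc] using hf 0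
  have hs : ∀ m, partialTheta q m = c (m + 1) := fun m => by simp [hc]
  simp only [add_zero, z₁, Nat.cast_zero, zero_mul] at h₂
  rw [h₀, h₂]
  simp only [hs, z₂, Nat.cast_zero, sub_zero]

/-- The difference of consecutive binomial coefficients in an odd row is a ballot number. -/
theorem choose_sub_choose_eq [CharZero K] (N m : ℕ) :
    ((2 * N + 1).choose (N + m + 1) : K) - ((2 * N + 1).choose (N + m + 2) : K) =
      (2 * (m : K) + 2) * ((2 * N + 1).choose (N + m + 1) : K) / ((N : K) + (m : K) + 2) := by
  have hne : (N : K) + (m : K) + 2 ≠ 0 := by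
    have : ((N + m + 2 : ℕ) : K) ≠ 0 := Nat.cast_ne_zero.2 (by omega)
    simpa using this
  rw [eq_div_iff hne]
  rcases le_or_gt m N with h | h
  · have := congrArg (Nat.cast (R := K)) (Nat.choose_succ_right_eq (2 * N + 1) (N + m + 1))
    rw [show 2 * N + 1 - (N + m + 1) = N - m by omega] at this
    push_cast [h] at this
    linear_combination -this
  · rw [Nat.choose_eq_zero_of_lt (by omega : 2 * N + 1 < N + m + 1),
      Nat.choose_eq_zero_of_lt (by omega : 2 * N + 1 < N + m + 2)]
    simp

end Closing

/-! ### The coefficient formula -/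

theorem corollary3 {K : Type*} [Field K] [CharZero K] (q : K) (hq0 : q ≠ 0) (hq1 : q ≠ 1)
    (N : ℕ) :
    PowerSeries.coeff (2 * N) (tangentGF q) =
      1 / (1 - q) ^ (2 * N + 1) *
        ∑ m ∈ Finset.range (N + 1),
          q ^ (m ^ 2 + 2 * m) *
            (∑ l ∈ Finset.Icc (-(m : ℤ)) ((m : ℤ) + 1), (-1 : K) ^ l * q ^ (-l ^ 2 + 2 * l)) *
            (2 * (m : K) + 2) * ((2 * N + 1).choose (N + m + 1) : K) / ((N : K) + (m : K) + 2) := by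
  have hne : (1 - q) ^ (2 * N + 1) ≠ 0 := pow_ne_zero _ (sub_ne_zero.2 hq1.symm)
  rw [coeff_tangentGF, one_div, eq_inv_mul_iff_mul_eq₀ hne]
  have h := one_sub_mul_stepOp_pow hq0 N
  rw [stepOp_pow_eq_pathSum, Pi.smul_apply, smul_eq_mul] at h
  rw [pow_succ', mul_assoc, h]
  refine Finset.sum_congr rfl fun m _ => ?_
  rw [choose_sub_choose_eq, partialTheta]
  ring
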